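/- Cubes in $\mathbb R^n$ are nondegenerate with sides parallel to the coordinate axes. For a real-valued locally integrable $f$ on $\mathbb R^n$ put $$Mf(x)=\sup_{Q\ni x}\frac1{|Q|}\int_Q|f|,\qquad M^\sharp f(x)=\sup_{Q\ni x}\frac1{|Q|}\int_Q|f-f_Q|,\qquad f_Q=\frac1{|Q|}\int_Q f,$$ with suprema over cubes. A weight is a locally integrable function $w$ on $\mathbb R^n$ with $w>0$ almost everywhere; $w(E)=\int_E w$. We write $w\in A_\infty$ if its Fujii--Wilson constant $$[w]_{A_\infty}=\sup_Q\frac1{w(Q)}\int_Q M(w\chi_Q)\,dx$$ is finite. For a measure $\mu$ and $g\ge 0$, $\|g\|_{\exp L(\mu)}=\inf\{s>0:\int (e^{g/s}-1)\,d\mu\le1\}$. For every $n$ there are constants $c_1,c_2,c_n,c_1',c_2'>0$ depending only on $n$ such that, for every locally integrable $f$ on $\mathbb R^n$ that is not almost everywhere equal to a constant and for which $Mf$ is not identically infinite, and for every $w\in A_\infty$, the following hold. (1) For every cube $Q$ and every $t>0$, $$w\Big(\Big\{x\in Q:\frac{Mf(x)-\operatorname{ess\,inf}_Q Mf}{M^\sharp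 f(x)}>t\Big\}\Big)\le c_1e^{-c_2t/[w]_{A_\infty}}\,w(Q).$$ (2) For every cube $Q$, $$\Big\|\frac{Mf-\operatorname{ess\,inf}_Q Mf}{M^\sharp f}\Big\|_{\exp L(Q,\,w(x)dx/w(Q))}\le c_n[w]_{A_\infty}.$$ (3) For every cube $Q$ and all $\lambda,\gamma>0$, $$w\big(\{x\in Q: Mf(x)-\operatorname{ess\,inf}_Q Mf>\lambda,\ M^\sharp f(x)\le\gamma\lambda\}\big)\le c_1'e^{-c_2'/([w]_{A_\infty}\gamma)}\,w(Q).$$ -/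

import Mathlib

open MeasureTheory Set
open scoped ENNReal NNReal

noncomputable section

namespace MaximalBLO

/-- A (closed, nondegenerate) cube in `ℝⁿ` with sides parallel to the coordinate axes. -/
def IsCube {n : ℕ} (Q : Set (Fin n → ℝ)) : Prop :=
  ∃ (a : Fin n → ℝ) (l : ℝ), 0 < l ∧ Q = Icc a (fun i => a i + l)

/-- The (non-centred) Hardy-Littlewood maximal function
`M f (x) = sup_{Q ∋ x} |Q|⁻¹ ∫_Q |f|`, with values in `[0, ∞]`. -/
def maximal {n : ℕ} (f : (Fin n → ℝ) → ℝ) (x : Fin n → ℝ) : ℝ≥0∞ :=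
  ⨆ (Q : Set (Fin n → ℝ)) (_ : IsCube Q) (_ : x ∈ Q), (volume Q)⁻¹ * ∫⁻ y in Q, ‖f y‖ₑ

/-- The Fefferman-Stein sharp maximal function
`M^♯ f (x) = sup_{Q ∋ x} |Q|⁻¹ ∫_Q |f - f_Q|`, where `f_Q = |Q|⁻¹ ∫_Q f`. -/
def sharpMaximal {n : ℕ} (f : (Fin n → ℝ) → ℝ) (x : Fin n → ℝ) : ℝ≥0∞ :=
  ⨆ (Q : Set (Fin n → ℝ)) (_ : IsCube Q) (_ : x ∈ Q), (volume Q)⁻¹ * ∫⁻ y in Q, ‖f y - ⨍ z in Q, f z‖ₑ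

/-- A weight: a locally integrable function that is positive almost everywhere. -/
structure IsWeight {n : ℕ} (w : (Fin n → ℝ) → ℝ) : Prop where
  locallyIntegrable : LocallyIntegrable w volume
  pos : ∀ᵐ x, 0 < w x

/-- The measure `w(x) dx`, so that `weightMeasure w E` is `w(E)`. -/
def weightMeasure {n : ℕ} (w : (Fin n → ℝ) → ℝ) : Measure (Fin n → ℝ) :=
  volume.withDensity (fun x => ENNReal.ofReal (w x))

/-- The Fujii-Wilson constant `[w]_{A_∞} = sup_Q w(Q)⁻¹ ∫_Q M(w χ_Q)`. -/
def aInftyConst {n : ℕ} (w : (Fin n → ℝ) → ℝ) : ℝ≥0∞ :=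
  ⨆ (Q : Set (Fin n → ℝ)) (_ : IsCube Q),
    (weightMeasure w Q)⁻¹ * ∫⁻ x in Q, maximal (Q.indicator w) x

/-- The class `A_∞`: weights with finite Fujii-Wilson constant. -/
structure IsAInfty {n : ℕ} (w : (Fin n → ℝ) → ℝ) : Prop extends IsWeight w where
  const_lt_top : aInftyConst w < ∞

/-- The lower oscillation `M f (x) - ess inf_Q M f`. The subtraction is that of `[0, ∞]`; it is the
usual one for almost every `x ∈ Q`, since there `M f (x) ≥ ess inf_Q M f`. -/
def maximalOsc {n : ℕ} (f : (Fin n → ℝ) → ℝ) (Q : Set (Fin n → ℝ)) (x : Fin n → ℝ) : ℝ≥0∞ :=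
  maximal f x - essInf (maximal f) (volume.restrict Q)

/-- The quotient `(M f (x) - ess inf_Q M f) / M^♯ f (x)`. -/
def oscQuotient {n : ℕ} (f : (Fin n → ℝ) → ℝ) (Q : Set (Fin n → ℝ)) (x : Fin n → ℝ) : ℝ≥0∞ :=
  maximalOsc f Q x / sharpMaximal f x

/-- The Luxemburg norm of the Orlicz space `exp L(μ)`, of Young function `e^t - 1`, evaluated at a
function `g` with values in `[0, ∞]`: the infimum of all `s > 0` with `∫ (e^{g/s} - 1) dμ ≤ 1`
(it is `∞` if there is no such `s`). -/
def expLNorm {α : Type*} [MeasurableSpace α] (g : α → ℝ≥0∞) (μ : Measure α) : ℝ≥0∞ :=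
  ⨅ (s : ℝ≥0) (_ : 0 < s)
    (_ : ∫⁻ x, (EReal.exp ((g x / (s : ℝ≥0∞) : ℝ≥0∞) : EReal) - 1) ∂μ ≤ 1), (s : ℝ≥0∞)

/-- The probability measure `w(x) dx / w(Q)` on `Q`. -/
def normalizedWeight {n : ℕ} (w : (Fin n → ℝ) → ℝ) (Q : Set (Fin n → ℝ)) :
    Measure (Fin n → ℝ) :=
  (weightMeasure w Q)⁻¹ • (weightMeasure w).restrict Q

end MaximalBLO

end

/-! Fix a cube `Q` and run an iterated Calderón-Zygmund stopping time on its dyadic grid. Inside a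
grid cube `q`, stop at the maximal dyadic `p ⊆ q` on which the mean of `|f - f_q|` exceeds twice its
mean over `q`, then restart from each stopped `p`. By Chebyshev the stopped cubes cover at most half
of `q` (`stoppingCubes_half`), so the family is sparse. The threshold is relative to the oscillation
of `f` on the current cube, hence one generation moves the average of `f` by at most `2 ^ (n + 1)`
times an oscillation that is itself at most `M^♯ f (x)` at every point `x` of the cube.

Thus, if `x` lies outside the `N`-th layer, all dyadic averages at `x` are within `N * 2 ^ (n + 1) *
M^♯ f (x)` of `f_Q`. An arbitrary cube through `x` is compared with a dyadic cube of similar size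
or, if it is larger than `Q`, with a cube containing both. This gives `M f (x) ≤ (2 * 3 ^ n + N * 2
^ (n + 1)) M^♯ f (x) + M f (y)` for every `y ∈ Q` (`maximal_le_add_of_notMem_layer`), and `y` then
yields the essential infimum.

The weight enters only through the size of the layers. Sparseness and the Fujii-Wilson condition
give a Carleson packing bound, `∑ w(layer k) ≤ 2 [w] w(Q)`. As it holds from every grid cube, the
`w`-measure at least halves every `⌈4 [w]⌉` generations (`IsSparse.measure_layer_mul_le`). Hence the
exponential decay (1) at rate `1 / [w]`; (2) integrates it and (3) is the case `t = 1 / γ`. -/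

namespace MaximalBLO

/-! ### Sparse families: Carleson packing and decay of the layers -/

section Sparse

variable {X ι : Type*}

/-- The `k`-th generation of descendants of `Q` under the successor relation `next`. -/
def descendants (next : ι → Set ι) : ℕ → ι → Set ι
  | 0, Q => {Q}
  | k + 1, Q => ⋃ S ∈ next Q, descendants next k S

/-- The set covered by the `k`-th generation of descendants of `Q`. -/
def layer (cube : ι → Set X) (next : ι → Set ι) (k : ℕ) (Q : ι) : Set X :=
  ⋃ S ∈ descendants next k Q, cube S

theorem descendants_one (next : ι → Set ι) (Q : ι) : descendants next 1 Q = next Q := by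
  simp [descendants]

theorem descendants_add (next : ι → Set ι) (j k : ℕ) (Q : ι) :
    descendants next (j + k) Q = ⋃ S ∈ descendants next j Q, descendants next k S := by
  induction j generalizing Q with
  | zero => simp [descendants]
  | succ j ih =>
    rw [show j + 1 + k = (j + k) + 1 by ring]
    simp only [descendants, ih, biUnion_iUnion]

theorem layer_zero (cube : ι → Set X) (next : ι → Set ι) (Q : ι) :
    layer cube next 0 Q = cube Q := by
  simp [layer, descendants]

theorem layer_one (cube : ι → Set X) (next : ι → Set ι) (Q : ι) :
    layer cube next 1 Q = ⋃ S ∈ next Q, cube S := by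
  simp [layer, descendants_one]

theorem layer_add (cube : ι → Set X) (next : ι → Set ι) (j k : ℕ) (Q : ι) :
    layer cube next (j + k) Q = ⋃ S ∈ descendants next j Q, layer cube next k S := by
  simp only [layer, descendants_add, biUnion_iUnion]

variable [MeasurableSpace X]

/-- Each `cube Q` has disjoint successors, contained in it, that cover at most half of it. -/
structure IsSparse (μ : Measure X) (cube : ι → Set X) (next : ι → Set ι) : Prop where
  measurable : ∀ Q, MeasurableSet (cube Q)
  finite : ∀ Q, μ (cube Q) ≠ ∞
  subset : ∀ Q, ∀ S ∈ next Q, cube S ⊆ cube Q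
  disjoint : ∀ Q, (next Q).PairwiseDisjoint cube
  half : ∀ Q, 2 * μ (⋃ S ∈ next Q, cube S) ≤ μ (cube Q)

namespace IsSparse

variable {μ : Measure X} {cube : ι → Set X} {next : ι → Set ι}

theorem layer_succ_subset (h : IsSparse μ cube next) (k : ℕ) (Q : ι) :
    layer cube next (k + 1) Q ⊆ layer cube next k Q := by
  rw [layer_add]
  refine iUnion₂_mono fun S _ => ?_
  rw [layer_one]
  exact iUnion₂_subset fun T hT => h.subset S T hT

theorem layer_antitone (h : IsSparse μ cube next) (Q : ι) :
    Antitone fun k => layer cube next k Q :=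
  antitone_nat_of_succ_le fun k => h.layer_succ_subset k Q

theorem layer_subset (h : IsSparse μ cube next) (k : ℕ) (Q : ι) :
    layer cube next k Q ⊆ cube Q :=
  (h.layer_antitone Q (Nat.zero_le k)).trans_eq (layer_zero cube next Q)

theorem descendants_disjoint (h : IsSparse μ cube next) (k : ℕ) (Q : ι) :
    (descendants next k Q).PairwiseDisjoint cube := by
  induction k generalizing Q with
  | zero => simp [descendants]
  | succ k ih =>
    intro S hS T hT hST
    simp only [descendants, mem_iUnion, exists_prop] at hS hT
    obtain ⟨S', hS', hS⟩ := hS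
    obtain ⟨T', hT', hT⟩ := hT
    by_cases hne : S' = T'
    · subst hne
      exact ih S' hS hT hST
    · refine (h.disjoint Q hS' hT' hne).mono ?_ ?_
      · exact (subset_biUnion_of_mem (u := cube) hS).trans (h.layer_subset k S')
      · exact (subset_biUnion_of_mem (u := cube) hT).trans (h.layer_subset k T')

theorem measure_le_two_mul_diff (h : IsSparse μ cube next) (Q : ι) :
    μ (cube Q) ≤ 2 * μ (cube Q \ layer cube next 1 Q) := by
  have h1 := h.half Q
  rw [← layer_one] at h1
  have h2 : μ (cube Q) ≤ μ (layer cube next 1 Q) + μ (cube Q \ layer cube next 1 Q) := by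
    refine le_trans (measure_mono ?_) (measure_union_le _ _)
    rw [union_sdiff_self]
    exact subset_union_right
  have h3 : μ (layer cube next 1 Q) ≠ ∞ :=
    ((measure_mono (h.layer_subset 1 Q)).trans_lt (h.finite Q).lt_top).ne
  have h4 : 2 * μ (cube Q) ≤ μ (cube Q) + 2 * μ (cube Q \ layer cube next 1 Q) :=
    calc 2 * μ (cube Q) ≤ 2 * (μ (layer cube next 1 Q) + μ (cube Q \ layer cube next 1 Q)) := by
          gcongr
      _ ≤ _ := by rw [mul_add]; gcongr
  rw [two_mul] at h4
  exact (ENNReal.add_le_add_iff_left (h.finite Q)).1 h4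

variable [Countable ι]

theorem measurableSet_layer (h : IsSparse μ cube next) (k : ℕ) (Q : ι) :
    MeasurableSet (layer cube next k Q) :=
  MeasurableSet.biUnion (to_countable _) fun S _ => h.measurable S

theorem measure_layer (h : IsSparse μ cube next) (ν : Measure X) (k : ℕ) (Q : ι) :
    ν (layer cube next k Q) = ∑' S : descendants next k Q, ν (cube S) :=
  measure_biUnion (to_countable _) (h.descendants_disjoint k Q) fun S _ => h.measurable S

/-- Each cube `S` of the layer keeps at least half of its `μ`-measure outside its successors. On
this remainder `g` dominates the ratio `ν(S) / μ(S)`, so `ν(S)` is at most twice the integral of `g`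
there. The remainders are disjoint and avoid the next layer. -/
theorem measure_layer_le_lintegral_diff (h : IsSparse μ cube next) {ν : Measure X}
    {g : X → ℝ≥0∞} (k : ℕ) (Q : ι)
    (hg : ∀ S, cube S ⊆ cube Q → ∀ x ∈ cube S, ν (cube S) ≤ μ (cube S) * g x) :
    ν (layer cube next k Q) ≤
      2 * ∫⁻ x in layer cube next k Q \ layer cube next (k + 1) Q, g x ∂μ := by
  have hm : ∀ S, MeasurableSet (cube S \ layer cube next 1 S) := fun S =>
    (h.measurable S).diff (h.measurableSet_layer 1 S)
  have hsub : (⋃ S ∈ descendants next k Q, cube S \ layer cube next 1 S) ⊆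
      layer cube next k Q \ layer cube next (k + 1) Q := by
    refine iUnion₂_subset fun S hS x hx => ⟨mem_biUnion hS hx.1, fun hx' => hx.2 ?_⟩
    rw [layer_add] at hx'
    obtain ⟨T, hT, hxT⟩ := mem_iUnion₂.1 hx'
    have : S = T := (h.descendants_disjoint k Q).elim_set hS hT x hx.1 (h.layer_subset 1 T hxT)
    rwa [this]
  calc ν (layer cube next k Q) = ∑' S : descendants next k Q, ν (cube S) := h.measure_layer ν k Q
    _ ≤ ∑' S : descendants next k Q, 2 * ∫⁻ x in cube S \ layer cube next 1 S, g x ∂μ := by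
      refine ENNReal.tsum_le_tsum fun S => ?_
      have hSQ : cube S ⊆ cube Q :=
        (subset_biUnion_of_mem (u := cube) S.2).trans (h.layer_subset k Q)
      -- If `μ(S) = 0` the ratio is meaningless, but the hypothesis on `g` at any point of `S`
      -- forces `ν(S) = 0`.
      by_cases h0 : μ (cube S) = 0
      · rcases (cube S).eq_empty_or_nonempty with he | ⟨x, hx⟩
        · simp [he]
        · have := hg S hSQ x hx
          rw [h0, zero_mul] at this
          exact this.trans zero_le
      · have h1 : ν (cube S) / μ (cube S) * μ (cube S \ layer cube next 1 S) ≤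
            ∫⁻ x in cube S \ layer cube next 1 S, g x ∂μ := by
          rw [← setLIntegral_const]
          refine setLIntegral_mono' (hm S) fun x hx => ?_
          exact ENNReal.div_le_of_le_mul' (hg S hSQ x hx.1)
        calc ν (cube S) = ν (cube S) / μ (cube S) * μ (cube S) :=
              (ENNReal.div_mul_cancel h0 (h.finite S)).symm
          _ ≤ ν (cube S) / μ (cube S) * (2 * μ (cube S \ layer cube next 1 S)) := by
              gcongr; exact h.measure_le_two_mul_diff S
          _ = 2 * (ν (cube S) / μ (cube S) * μ (cube S \ layer cube next 1 S)) := by ring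
          _ ≤ _ := by gcongr
    _ = 2 * ∫⁻ x in ⋃ S ∈ descendants next k Q, cube S \ layer cube next 1 S, g x ∂μ := by
      rw [ENNReal.tsum_mul_left, lintegral_biUnion (to_countable _) (fun S _ => hm S)]
      exact (h.descendants_disjoint k Q).mono_on fun S _ => sdiff_subset
    _ ≤ _ := by gcongr

/-- The Carleson packing condition of a sparse family, for a second measure. -/
theorem sum_measure_layer_le (h : IsSparse μ cube next) {ν : Measure X}
    {g : X → ℝ≥0∞} (N : ℕ) (Q : ι)
    (hg : ∀ S, cube S ⊆ cube Q → ∀ x ∈ cube S, ν (cube S) ≤ μ (cube S) * g x) :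
    ∑ k ∈ Finset.range N, ν (layer cube next k Q) ≤ 2 * ∫⁻ x in cube Q, g x ∂μ := by
  -- Telescoping over the nested layers; the last layer stays as a remainder, so no limit is taken.
  have key : ∑ k ∈ Finset.range N,
      ∫⁻ x in layer cube next k Q \ layer cube next (k + 1) Q, g x ∂μ +
        ∫⁻ x in layer cube next N Q, g x ∂μ = ∫⁻ x in cube Q, g x ∂μ := by
    induction N with
    | zero => simp [layer_zero]
    | succ N ih =>
      rw [Finset.sum_range_succ, add_assoc, ← ih]
      congr 1
      rw [add_comm, ← lintegral_inter_add_sdiff g (layer cube next N Q)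
        (h.measurableSet_layer (N + 1) Q), inter_eq_self_of_subset_right (h.layer_succ_subset N Q)]
  calc ∑ k ∈ Finset.range N, ν (layer cube next k Q)
      ≤ ∑ k ∈ Finset.range N,
        2 * ∫⁻ x in layer cube next k Q \ layer cube next (k + 1) Q, g x ∂μ :=
        Finset.sum_le_sum fun k _ => h.measure_layer_le_lintegral_diff k Q hg
    _ ≤ 2 * ∫⁻ x in cube Q, g x ∂μ := by
        rw [← Finset.mul_sum, ← key]
        gcongr
        exact le_self_add

/-- The Carleson packing condition makes the layers decay exponentially. -/
theorem measure_layer_mul_le (h : IsSparse μ cube next) {ν : Measure X} {A : ℝ≥0∞}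
    (hA : ∀ N Q, ∑ k ∈ Finset.range N, ν (layer cube next k Q) ≤ A * ν (cube Q))
    {L : ℕ} (hL0 : L ≠ 0) (hL : 2 * A ≤ L) (k : ℕ) (Q : ι) :
    ν (layer cube next (k * L) Q) ≤ 2⁻¹ ^ k * ν (cube Q) := by
  -- The layers decrease, so `L` copies of the `L`-th are bounded by the sum of the first `L`; as `L
  -- ≥ 2 * A`, its measure is at most half. This holds from every starting cube, so it can be
  -- iterated inside each descendant.
  have hhalf : ∀ Q, ν (layer cube next L Q) ≤ 2⁻¹ * ν (cube Q) := by
    intro Q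
    have h1 : L * ν (layer cube next L Q) ≤ A * ν (cube Q) := by
      refine le_trans ?_ (hA L Q)
      rw [← nsmul_eq_mul, ← Finset.card_range L, ← Finset.sum_const, Finset.card_range]
      exact Finset.sum_le_sum fun j hj =>
        measure_mono (h.layer_antitone Q (Finset.mem_range.1 hj).le)
    have hL' : (L : ℝ≥0∞) ≠ 0 := by exact_mod_cast hL0
    have h2 : A ≤ 2⁻¹ * L := by
      rw [mul_comm, ← div_eq_mul_inv, ENNReal.le_div_iff_mul_le (by simp) (by simp), mul_comm]
      exact hL
    have h3 : L * ν (layer cube next L Q) ≤ L * (2⁻¹ * ν (cube Q)) :=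
      h1.trans <| calc A * ν (cube Q) ≤ 2⁻¹ * L * ν (cube Q) := by gcongr
        _ = _ := by ring
    exact (ENNReal.mul_le_mul_iff_right hL' (ENNReal.natCast_ne_top L)).1 h3
  induction k with
  | zero => simp [layer_zero]
  | succ k ih =>
    rw [Nat.succ_mul, layer_add]
    calc ν (⋃ S ∈ descendants next (k * L) Q, layer cube next L S)
        ≤ ∑' S : descendants next (k * L) Q, ν (layer cube next L S) :=
          measure_biUnion_le ν (to_countable _) _
      _ ≤ ∑' S : descendants next (k * L) Q, 2⁻¹ * ν (cube S) :=
          ENNReal.tsum_le_tsum fun S => hhalf S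
      _ = 2⁻¹ * ν (layer cube next (k * L) Q) := by
          rw [ENNReal.tsum_mul_left, h.measure_layer ν]
      _ ≤ 2⁻¹ * (2⁻¹ ^ k * ν (cube Q)) := by gcongr
      _ = 2⁻¹ ^ (k + 1) * ν (cube Q) := by ring

end IsSparse

end Sparse

/-! ### Mean deviations from a constant -/

section MeanDev

variable {X : Type*} [MeasureSpace X] {f : X → ℝ} {S T : Set X}

/-- The mean deviation of `f` from the constant `c` over `S`. -/
noncomputable def meanDev (f : X → ℝ) (S : Set X) (c : ℝ) : ℝ≥0∞ :=
  (volume S)⁻¹ * ∫⁻ y in S, ‖f y - c‖ₑ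

theorem meanDev_congr_set (h : S =ᵐ[volume] T) (c : ℝ) : meanDev f S c = meanDev f T c := by
  rw [meanDev, meanDev, measure_congr h, Measure.restrict_congr_set h]

theorem meanDev_zero (f : X → ℝ) (S : Set X) :
    meanDev f S 0 = (volume S)⁻¹ * ∫⁻ y in S, ‖f y‖ₑ := by
  simp [meanDev]

theorem meanDev_le_add (h0 : volume S ≠ 0) (ht : volume S ≠ ∞) (c d : ℝ) :
    meanDev f S c ≤ meanDev f S d + ‖d - c‖ₑ := by
  calc meanDev f S c ≤ (volume S)⁻¹ * ∫⁻ y in S, (‖f y - d‖ₑ + ‖d - c‖ₑ) := by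
        refine mul_le_mul_right (lintegral_mono fun y => ?_) _
        calc ‖f y - c‖ₑ = ‖(f y - d) + (d - c)‖ₑ := by congr 1; ring
          _ ≤ _ := enorm_add_le _ _
    _ = meanDev f S d + ‖d - c‖ₑ := by
        rw [lintegral_add_right _ measurable_const, setLIntegral_const, mul_add, ← meanDev,
          mul_comm ‖d - c‖ₑ, ← mul_assoc, ENNReal.inv_mul_cancel h0 ht, one_mul]

theorem enorm_average_sub_le (hf : IntegrableOn f S) (h0 : volume S ≠ 0) (ht : volume S ≠ ∞)
    (c : ℝ) : ‖(⨍ y in S, f y) - c‖ₑ ≤ meanDev f S c := by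
  have h1 : (⨍ y in S, f y) - c = (volume.real S)⁻¹ * ∫ y in S, (f y - c) := by
    have hr : volume.real S ≠ 0 := (ENNReal.toReal_pos h0 ht).ne'
    rw [integral_sub hf (integrableOn_const ht), setAverage_eq, setIntegral_const, smul_eq_mul,
      smul_eq_mul]
    field_simp
  rw [h1, enorm_mul, meanDev]
  refine mul_le_mul' (le_of_eq ?_) (enorm_integral_le_lintegral_enorm _)
  rw [measureReal_def, ← ENNReal.toReal_inv, Real.enorm_eq_ofReal ENNReal.toReal_nonneg,
    ENNReal.ofReal_toReal (ENNReal.inv_ne_top.2 h0)]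

theorem meanDev_le_mul (hST : S ⊆ T) (h0 : volume S ≠ 0) (ht : volume T ≠ ∞) {K : ℝ≥0∞}
    (hK : volume T ≤ K * volume S) (c : ℝ) : meanDev f S c ≤ K * meanDev f T c := by
  have hS : volume S ≠ ∞ := ((measure_mono hST).trans_lt ht.lt_top).ne
  have hT : volume T ≠ 0 := fun h => h0 (measure_mono_null hST h)
  have h1 : (volume S)⁻¹ ≤ K * (volume T)⁻¹ :=
    calc (volume S)⁻¹ = (volume S)⁻¹ * (volume T * (volume T)⁻¹) := by
          rw [ENNReal.mul_inv_cancel hT ht, mul_one]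
      _ ≤ (volume S)⁻¹ * (K * volume S * (volume T)⁻¹) := by gcongr
      _ = (volume S)⁻¹ * volume S * (K * (volume T)⁻¹) := by ring
      _ = _ := by rw [ENNReal.inv_mul_cancel h0 hS, one_mul]
  rw [meanDev, meanDev, ← mul_assoc]
  exact mul_le_mul' h1 (lintegral_mono_set hST)

end MeanDev

/-! ### The dyadic grid of a cube -/

section Grid

variable {n : ℕ}

theorem volume_Icc_cube (b : Fin n → ℝ) (r : ℝ) :
    volume (Icc b (fun i => b i + r)) = ENNReal.ofReal r ^ n := by
  simp [Real.volume_Icc_pi]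

/-- The integer coordinates of the cube of generation `m` containing `y`, in the dyadic grid
generated by the half-open cube with corner `a` and side `l`. -/
noncomputable def gridIndex (a : Fin n → ℝ) (l : ℝ) (m : ℕ) (y : Fin n → ℝ) : Fin n → ℤ :=
  fun i => ⌊(y i - a i) / l * 2 ^ m⌋

/-- The half-open cubes of the dyadic grid, indexed by generation and integer coordinates. -/
def gridCube (a : Fin n → ℝ) (l : ℝ) (p : ℕ × (Fin n → ℤ)) : Set (Fin n → ℝ) :=
  {y | gridIndex a l p.1 y = p.2}

/-- The closed cube with the same interior as `gridCube`. -/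
def closedGridCube (a : Fin n → ℝ) (l : ℝ) (p : ℕ × (Fin n → ℤ)) : Set (Fin n → ℝ) :=
  Icc (fun i => a i + p.2 i * (l / 2 ^ p.1)) (fun i => a i + p.2 i * (l / 2 ^ p.1) + l / 2 ^ p.1)

variable {a : Fin n → ℝ} {l : ℝ} {p q : ℕ × (Fin n → ℤ)}

theorem mem_gridCube_gridIndex (a : Fin n → ℝ) (l : ℝ) (m : ℕ) (x : Fin n → ℝ) :
    x ∈ gridCube a l (m, gridIndex a l m x) := rfl

theorem eq_of_mem_gridCube {x : Fin n → ℝ} (hx : x ∈ gridCube a l p) :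
    (p.1, gridIndex a l p.1 x) = p := by
  rw [show gridIndex a l p.1 x = p.2 from hx]

/-- Nestedness of the grid: the coarser index is the floor quotient of the finer one by a power of
two, so the finer determines the coarser. -/
theorem gridIndex_eq_of_le {m m' : ℕ} (h : m ≤ m') {x y : Fin n → ℝ}
    (hxy : gridIndex a l m' x = gridIndex a l m' y) : gridIndex a l m x = gridIndex a l m y := by
  have key : ∀ (z : Fin n → ℝ) i, gridIndex a l m z i = gridIndex a l m' z i / (2 ^ (m' - m) : ℕ) := by
    intro z i
    rw [gridIndex, gridIndex, ← Int.floor_div_natCast]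
    congr 1
    obtain ⟨k, rfl⟩ := Nat.exists_eq_add_of_le h
    rw [Nat.add_sub_cancel_left, pow_add]
    push_cast
    field_simp
  ext i
  rw [key, key, hxy]

theorem gridCube_subset {x : Fin n → ℝ} (hp : x ∈ gridCube a l p) (hq : x ∈ gridCube a l q)
    (h : q.1 ≤ p.1) : gridCube a l p ⊆ gridCube a l q := fun _ hy =>
  (gridIndex_eq_of_le h (Eq.trans hy (Eq.symm hp))).trans hq

theorem gridCube_eq_pi (hl : 0 < l) (p : ℕ × (Fin n → ℤ)) :
    gridCube a l p = univ.pi fun i => Ico (a i + p.2 i * (l / 2 ^ p.1))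
      (a i + p.2 i * (l / 2 ^ p.1) + l / 2 ^ p.1) := by
  ext y
  have h2 : (0 : ℝ) < 2 ^ p.1 := by positivity
  simp only [gridCube, mem_ofPred_eq, mem_univ_pi, funext_iff, gridIndex, Int.floor_eq_iff, mem_Ico]
  refine forall_congr' fun i => and_congr ?_ ?_
  · rw [← div_le_iff₀ h2, le_div_iff₀ hl]
    constructor <;> intro h <;>
      linarith [show (p.2 i : ℝ) / 2 ^ p.1 * l = p.2 i * (l / 2 ^ p.1) by ring]
  · rw [← lt_div_iff₀ h2, div_lt_iff₀ hl]
    constructor <;> intro h <;>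
      linarith [show ((p.2 i : ℝ) + 1) / 2 ^ p.1 * l =
        p.2 i * (l / 2 ^ p.1) + l / 2 ^ p.1 by ring]

theorem isCube_closedGridCube (hl : 0 < l) (p : ℕ × (Fin n → ℤ)) :
    IsCube (closedGridCube a l p) :=
  ⟨_, l / 2 ^ p.1, by positivity, rfl⟩

theorem gridCube_subset_closed (hl : 0 < l) (p : ℕ × (Fin n → ℤ)) :
    gridCube a l p ⊆ closedGridCube a l p := by
  rw [gridCube_eq_pi hl]
  exact fun _ hy => ⟨fun i => (hy i trivial).1, fun i => (hy i trivial).2.le⟩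

theorem gridCube_ae_eq (hl : 0 < l) (p : ℕ × (Fin n → ℤ)) :
    gridCube a l p =ᵐ[volume] closedGridCube a l p := by
  rw [gridCube_eq_pi hl]
  exact Measure.univ_pi_Ico_ae_eq_Icc

theorem closedGridCube_zero (a : Fin n → ℝ) (l : ℝ) :
    closedGridCube a l (0, 0) = Icc a (fun i => a i + l) := by
  simp [closedGridCube]

theorem measurableSet_gridCube (hl : 0 < l) (p : ℕ × (Fin n → ℤ)) :
    MeasurableSet (gridCube a l p) := by
  rw [gridCube_eq_pi hl]
  exact MeasurableSet.univ_pi fun i => measurableSet_Ico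

theorem volume_gridCube (hl : 0 < l) (p : ℕ × (Fin n → ℤ)) :
    volume (gridCube a l p) = ENNReal.ofReal (l / 2 ^ p.1) ^ n := by
  rw [measure_congr (gridCube_ae_eq hl p), closedGridCube, volume_Icc_cube]

theorem volume_gridCube_ne_zero (hl : 0 < l) (p : ℕ × (Fin n → ℤ)) :
    volume (gridCube a l p) ≠ 0 := by
  rw [volume_gridCube hl]
  exact pow_ne_zero _ (ENNReal.ofReal_pos.2 (by positivity)).ne'

theorem volume_gridCube_ne_top (hl : 0 < l) (p : ℕ × (Fin n → ℤ)) :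
    volume (gridCube a l p) ≠ ∞ := by
  rw [volume_gridCube hl]
  exact ENNReal.pow_ne_top ENNReal.ofReal_ne_top

theorem volume_gridCube_of_succ (hl : 0 < l) (h : p.1 = q.1 + 1) :
    volume (gridCube a l q) = 2 ^ n * volume (gridCube a l p) := by
  rw [volume_gridCube hl, volume_gridCube hl, ← mul_pow, h]
  congr 1
  rw [show (2 : ℝ≥0∞) = ENNReal.ofReal 2 by simp, ← ENNReal.ofReal_mul (by norm_num)]
  congr 1
  rw [pow_succ]
  field_simp

theorem integrableOn_gridCube {f : (Fin n → ℝ) → ℝ} (hf : LocallyIntegrable f volume) (hl : 0 < l)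
    (p : ℕ × (Fin n → ℤ)) : IntegrableOn f (gridCube a l p) :=
  (hf.integrableOn_isCompact isCompact_Icc).mono_set (gridCube_subset_closed hl p)

theorem meanDev_average_le_sharpMaximal (f : (Fin n → ℝ) → ℝ) {Q : Set (Fin n → ℝ)}
    (hQ : IsCube Q) {x : Fin n → ℝ} (hx : x ∈ Q) :
    meanDev f Q (⨍ y in Q, f y) ≤ sharpMaximal f x :=
  le_iSup_of_le Q <| le_iSup_of_le hQ <| le_iSup_of_le hx le_rfl

theorem meanDev_zero_le_maximal (f : (Fin n → ℝ) → ℝ) {Q : Set (Fin n → ℝ)}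
    (hQ : IsCube Q) {x : Fin n → ℝ} (hx : x ∈ Q) :
    meanDev f Q 0 ≤ maximal f x := by
  rw [meanDev_zero]
  exact le_iSup_of_le Q <| le_iSup_of_le hQ <| le_iSup_of_le hx le_rfl

theorem meanDev_gridCube_average_le_sharpMaximal (f : (Fin n → ℝ) → ℝ) (hl : 0 < l)
    {x : Fin n → ℝ} (hx : x ∈ gridCube a l p) :
    meanDev f (gridCube a l p) (⨍ y in gridCube a l p, f y) ≤ sharpMaximal f x := by
  rw [setAverage_congr (gridCube_ae_eq hl p), meanDev_congr_set (gridCube_ae_eq hl p)]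
  exact meanDev_average_le_sharpMaximal f (isCube_closedGridCube hl p)
    (gridCube_subset_closed hl p hx)

end Grid

/-! ### Stopping cubes and the growth of dyadic averages -/

section Stopping

variable {n : ℕ} {f : (Fin n → ℝ) → ℝ} {a : Fin n → ℝ} {l : ℝ} {p q : ℕ × (Fin n → ℤ)}

/-- The mean deviation of `f` over the grid cube `p` from its average over the grid cube `q`. -/
noncomputable def gridDev (f : (Fin n → ℝ) → ℝ) (a : Fin n → ℝ) (l : ℝ)
    (p q : ℕ × (Fin n → ℤ)) : ℝ≥0∞ :=
  meanDev f (gridCube a l p) (⨍ y in gridCube a l q, f y)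

/-- The Calderón-Zygmund cubes of `f - f_Q` in the grid cube `Q`, at twice the mean oscillation
of `f` over `Q`. -/
def stoppingCubes (f : (Fin n → ℝ) → ℝ) (a : Fin n → ℝ) (l : ℝ) (q : ℕ × (Fin n → ℤ)) :
    Set (ℕ × (Fin n → ℤ)) :=
  {p | q.1 < p.1 ∧ gridCube a l p ⊆ gridCube a l q ∧ 2 * gridDev f a l q q < gridDev f a l p q ∧
    ∀ r : ℕ × (Fin n → ℤ), q.1 < r.1 → r.1 < p.1 → gridCube a l p ⊆ gridCube a l r →
      gridDev f a l r q ≤ 2 * gridDev f a l q q}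

/-- Grid cubes that meet are nested, and the larger of two would violate the maximality clause of
the smaller. -/
theorem stoppingCubes_pairwiseDisjoint (f : (Fin n → ℝ) → ℝ) (a : Fin n → ℝ) (l : ℝ)
    (q : ℕ × (Fin n → ℤ)) : (stoppingCubes f a l q).PairwiseDisjoint (gridCube a l) := by
  intro p hp r hr hne
  refine disjoint_left.2 fun x hxp hxr => ?_
  rcases lt_trichotomy p.1 r.1 with h | h | h
  · exact (hr.2.2.2 p hp.1 h (gridCube_subset hxr hxp h.le)).not_gt hp.2.2.1
  · exact hne (by rw [← eq_of_mem_gridCube hxp, ← eq_of_mem_gridCube hxr, h])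
  · exact (hp.2.2.2 r hr.1 h (gridCube_subset hxp hxr h.le)).not_gt hr.2.2.1

/-- Chebyshev's inequality for `|f - f_q|`, summed over the disjoint stopping cubes. -/
theorem stoppingCubes_half (f : (Fin n → ℝ) → ℝ) (a : Fin n → ℝ) (hl : 0 < l)
    (q : ℕ × (Fin n → ℤ)) :
    2 * volume (⋃ p ∈ stoppingCubes f a l q, gridCube a l p) ≤ volume (gridCube a l q) := by
  set c := ⨍ y in gridCube a l q, f y with hc
  set D := gridDev f a l q q with hD
  have hmul : ∀ p, gridDev f a l p q * volume (gridCube a l p) =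
      ∫⁻ y in gridCube a l p, ‖f y - c‖ₑ := fun p => by
    rw [gridDev, meanDev, mul_comm, ← mul_assoc, ENNReal.mul_inv_cancel
      (volume_gridCube_ne_zero hl p) (volume_gridCube_ne_top hl p), one_mul]
  -- `D` is cancelled at the end. If it is infinite nothing exceeds `2 * D`, and if it is zero then
  -- `f = c` almost everywhere on the cube; either way there are no stopping cubes.
  by_cases hDt : D = ∞
  · have : stoppingCubes f a l q = ∅ := by
      refine eq_empty_of_forall_notMem fun p hp => ?_
      have := hp.2.2.1
      rw [← hD, hDt] at this
      simp at this
    simp [this]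
  have hsum : 2 * D * volume (⋃ p ∈ stoppingCubes f a l q, gridCube a l p) ≤
      D * volume (gridCube a l q) := by
    calc 2 * D * volume (⋃ p ∈ stoppingCubes f a l q, gridCube a l p)
        ≤ 2 * D * ∑' p : stoppingCubes f a l q, volume (gridCube a l p) := by
          gcongr; exact measure_biUnion_le _ (to_countable _) _
      _ = ∑' p : stoppingCubes f a l q, 2 * D * volume (gridCube a l p) :=
          ENNReal.tsum_mul_left.symm
      _ ≤ ∑' p : stoppingCubes f a l q, ∫⁻ y in gridCube a l p, ‖f y - c‖ₑ := by
          refine ENNReal.tsum_le_tsum fun p => ?_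
          rw [← hmul]
          gcongr
          exact p.2.2.2.1.le
      _ = ∫⁻ y in ⋃ p ∈ stoppingCubes f a l q, gridCube a l p, ‖f y - c‖ₑ :=
          (lintegral_biUnion (to_countable _) (fun p _ => measurableSet_gridCube hl p)
            (stoppingCubes_pairwiseDisjoint f a l q) _).symm
      _ ≤ ∫⁻ y in gridCube a l q, ‖f y - c‖ₑ :=
          lintegral_mono_set (iUnion₂_subset fun p hp => hp.2.1)
      _ = _ := (hmul q).symm
  by_cases hD0 : D = 0
  · have : stoppingCubes f a l q = ∅ := by
      refine eq_empty_of_forall_notMem fun p hp => ?_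
      have h1 := hp.2.2.1
      have h2 : gridDev f a l p q * volume (gridCube a l p) ≤ 0 := by
        rw [hmul, ← zero_mul (volume (gridCube a l q)), ← hD0, hD, hmul]
        exact lintegral_mono_set hp.2.1
      rw [← hD, hD0, mul_zero] at h1
      rcases mul_eq_zero.1 (le_antisymm h2 zero_le) with h | h
      · exact h1.ne' h
      · exact volume_gridCube_ne_zero hl p h
    simp [this]
  rw [mul_comm 2 D, mul_assoc] at hsum
  exact (ENNReal.mul_le_mul_iff_right hD0 hDt).1 hsum

theorem isSparse_stoppingCubes (f : (Fin n → ℝ) → ℝ) (a : Fin n → ℝ) (hl : 0 < l) :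
    IsSparse volume (gridCube a l) (stoppingCubes f a l) where
  measurable := measurableSet_gridCube hl
  finite := volume_gridCube_ne_top hl
  subset _ _ hp := hp.2.1
  disjoint := stoppingCubes_pairwiseDisjoint f a l
  half := stoppingCubes_half f a hl

theorem enorm_gridAverage_sub_le (hf : LocallyIntegrable f volume) (hl : 0 < l)
    (p q : ℕ × (Fin n → ℤ)) :
    ‖(⨍ y in gridCube a l p, f y) - ⨍ y in gridCube a l q, f y‖ₑ ≤ gridDev f a l p q :=
  enorm_average_sub_le (integrableOn_gridCube hf hl p) (volume_gridCube_ne_zero hl p)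
    (volume_gridCube_ne_top hl p) _

/-- The dyadic parent was not stopped (or is `q` itself), so its deviation is at most twice that of
`q`; passing to the child costs the volume ratio `2 ^ n`. -/
theorem gridDev_le_of_mem_stoppingCubes (hl : 0 < l) (hp : p ∈ stoppingCubes f a l q) :
    gridDev f a l p q ≤ 2 ^ (n + 1) * gridDev f a l q q := by
  obtain ⟨x, hx⟩ : (gridCube a l p).Nonempty := by
    by_contra h
    exact volume_gridCube_ne_zero hl p (by rw [not_nonempty_iff_eq_empty.1 h, measure_empty])
  obtain ⟨m, hm⟩ : ∃ m, p.1 = m + 1 := Nat.exists_eq_succ_of_ne_zero (Nat.ne_zero_of_lt hp.1)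
  have hxr := mem_gridCube_gridIndex a l m x
  set r := (m, gridIndex a l m x) with hr
  have hsub : gridCube a l p ⊆ gridCube a l r := gridCube_subset hx hxr (by simp [hr, hm])
  have hr2 : gridDev f a l r q ≤ 2 * gridDev f a l q q := by
    rcases (Nat.lt_succ_iff.1 (hp.1.trans_eq hm)).eq_or_lt with h | h
    · have : r = q := by
        rw [← eq_of_mem_gridCube (hp.2.1 hx), hr, h]
      rw [this, two_mul]
      exact le_self_add
    · exact hp.2.2.2 r h (by simp [hr, hm]) hsub
  calc gridDev f a l p q ≤ 2 ^ n * gridDev f a l r q :=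
        meanDev_le_mul hsub (volume_gridCube_ne_zero hl p) (volume_gridCube_ne_top hl r)
          (volume_gridCube_of_succ hl (by simp [hr, hm])).le _
    _ ≤ 2 ^ n * (2 * gridDev f a l q q) := by gcongr
    _ = _ := by ring

/-- Outside the `N`-th layer of stopping cubes, the dyadic averages of `f` differ from the initial
one by at most `N` multiples of the sharp maximal function. -/
theorem enorm_gridAverage_sub_le_of_notMem_layer (hf : LocallyIntegrable f volume) (hl : 0 < l)
    {x : Fin n → ℝ} (N : ℕ) (q : ℕ × (Fin n → ℤ)) (hxq : x ∈ gridCube a l q)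
    (hx : x ∉ layer (gridCube a l) (stoppingCubes f a l) N q)
    (p : ℕ × (Fin n → ℤ)) (hxp : x ∈ gridCube a l p) (hqp : q.1 ≤ p.1) :
    ‖(⨍ y in gridCube a l p, f y) - ⨍ y in gridCube a l q, f y‖ₑ ≤
      N * (2 ^ (n + 1) * sharpMaximal f x) := by
  induction N generalizing q with
  | zero => exact absurd (by rwa [layer_zero]) hx
  | succ N ih =>
    have hosc : gridDev f a l q q ≤ sharpMaximal f x :=
      meanDev_gridCube_average_le_sharpMaximal f hl hxq
    -- If some cube through `x` between `q` and `p` exceeds the threshold, the first one, `s`, is a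
    -- stopping cube. The jump from `q` to `s` costs one unit, and the induction hypothesis
    -- restarted at `s` covers the rest.
    by_cases hex : ∃ m, q.1 < m ∧ m ≤ p.1 ∧
        2 * gridDev f a l q q < gridDev f a l (m, gridIndex a l m x) q
    · classical
      have hspec := Nat.find_spec hex
      have hmin : ∀ m, m < Nat.find hex → q.1 < m →
          gridDev f a l (m, gridIndex a l m x) q ≤ 2 * gridDev f a l q q := fun m hm hqm =>
        not_lt.1 fun h => Nat.find_min hex hm ⟨hqm, hm.le.trans hspec.2.1, h⟩
      set m := Nat.find hex
      have hxs := mem_gridCube_gridIndex a l m x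
      set s := (m, gridIndex a l m x) with hs
      have hmem : s ∈ stoppingCubes f a l q := by
        refine ⟨hspec.1, gridCube_subset hxs hxq hspec.1.le, hspec.2.2, fun r hqr hrs hsr => ?_⟩
        rw [← eq_of_mem_gridCube (hsr hxs)]
        exact hmin r.1 hrs hqr
      have hxN : x ∉ layer (gridCube a l) (stoppingCubes f a l) N s := by
        refine fun h => hx ?_
        rw [add_comm, layer_add, descendants_one]
        exact mem_biUnion hmem h
      calc ‖(⨍ y in gridCube a l p, f y) - ⨍ y in gridCube a l q, f y‖ₑ
          = ‖((⨍ y in gridCube a l p, f y) - ⨍ y in gridCube a l s, f y) +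
              ((⨍ y in gridCube a l s, f y) - ⨍ y in gridCube a l q, f y)‖ₑ := by
            congr 1; ring
        _ ≤ N * (2 ^ (n + 1) * sharpMaximal f x) + 2 ^ (n + 1) * sharpMaximal f x := by
            refine (enorm_add_le _ _).trans (add_le_add (ih s hxs hxN hspec.2.1) ?_)
            refine (enorm_gridAverage_sub_le hf hl s q).trans ?_
            refine (gridDev_le_of_mem_stoppingCubes hl hmem).trans ?_
            gcongr
        _ = _ := by push_cast; ring
    -- With no stop before `p`, the deviation over `p` is at most `2 M^♯ f (x)`, which fits into a
    -- single unit.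
    · have h1 : gridDev f a l p q ≤ 2 * gridDev f a l q q := by
        rcases hqp.eq_or_lt with h | h
        · have : p = q := by rw [← eq_of_mem_gridCube hxp, ← eq_of_mem_gridCube hxq, h]
          rw [this, two_mul]
          exact le_self_add
        · refine not_lt.1 fun hlt => hex ⟨p.1, h, le_rfl, ?_⟩
          rwa [eq_of_mem_gridCube hxp]
      calc _ ≤ 2 * gridDev f a l q q := (enorm_gridAverage_sub_le hf hl p q).trans h1
        _ ≤ 2 * sharpMaximal f x := by gcongr
        _ = 1 * (2 ^ 1 * sharpMaximal f x) := by ring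
        _ ≤ (N + 1 : ℕ) * (2 ^ (n + 1) * sharpMaximal f x) := by
          gcongr
          · exact_mod_cast Nat.le_add_left 1 N
          · norm_num
          · omega

end Stopping

/-! ### From dyadic averages to the maximal function -/

section Comparison

variable {n : ℕ} {f : (Fin n → ℝ) → ℝ}

theorem volume_cube_ne_zero (b : Fin n → ℝ) {r : ℝ} (hr : 0 < r) :
    volume (Icc b (fun i => b i + r)) ≠ 0 := by
  rw [volume_Icc_cube]
  exact pow_ne_zero _ (ENNReal.ofReal_pos.2 hr).ne'

theorem volume_cube_ne_top (b : Fin n → ℝ) (r : ℝ) :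
    volume (Icc b (fun i => b i + r)) ≠ ∞ := by
  rw [volume_Icc_cube]
  exact ENNReal.pow_ne_top ENNReal.ofReal_ne_top

theorem volume_cube_le_mul (b c : Fin n → ℝ) {r s : ℝ} (k : ℕ) (h : s ≤ k * r) :
    volume (Icc c (fun i => c i + s)) ≤ k ^ n * volume (Icc b (fun i => b i + r)) := by
  rw [volume_Icc_cube, volume_Icc_cube, ← mul_pow]
  gcongr
  rw [← ENNReal.ofReal_natCast, ← ENNReal.ofReal_mul (by positivity)]
  exact ENNReal.ofReal_le_ofReal h

/-- Two cubes with a common point lie in a cube whose side is the sum of their sides. -/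
theorem exists_cube_union_subset {b c x : Fin n → ℝ} {r s : ℝ}
    (hxb : x ∈ Icc b (fun i => b i + r)) (hxc : x ∈ Icc c (fun i => c i + s)) :
    ∃ d : Fin n → ℝ, Icc b (fun i => b i + r) ⊆ Icc d (fun i => d i + (r + s)) ∧
      Icc c (fun i => c i + s) ⊆ Icc d (fun i => d i + (r + s)) := by
  refine ⟨fun i => min (b i) (c i), fun y hy => ⟨fun i => ?_, fun i => ?_⟩,
    fun y hy => ⟨fun i => ?_, fun i => ?_⟩⟩
  all_goals
    have h1 := hxb.1 i
    have h2 := hxb.2 i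
    have h3 := hxc.1 i
    have h4 := hxc.2 i
    have h5 := hy.1 i
    have h6 := hy.2 i
    dsimp only at h1 h2 h3 h4 h5 h6 ⊢
    rcases min_cases (b i) (c i) with h | h <;> linarith

theorem integrableOn_cube (hf : LocallyIntegrable f volume) (b : Fin n → ℝ) (r : ℝ) :
    IntegrableOn f (Icc b (fun i => b i + r)) :=
  hf.integrableOn_isCompact isCompact_Icc

/-- Both cubes lie in a cube `T` of side `r + s ≤ 3 * r`. Passing from `T` to either of them costs
at most `3 ^ n`, and `f_T` is the intermediate constant; hence the factor `2 * 3 ^ n`. -/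
theorem meanDev_average_le_of_comparable (hf : LocallyIntegrable f volume)
    {b c x : Fin n → ℝ} {r s : ℝ} (hr : 0 < r) (hrs : r ≤ s) (hsr : s ≤ 2 * r)
    (hxb : x ∈ Icc b (fun i => b i + r)) (hxc : x ∈ Icc c (fun i => c i + s)) :
    meanDev f (Icc b (fun i => b i + r)) (⨍ y in Icc c (fun i => c i + s), f y) ≤
      2 * 3 ^ n * sharpMaximal f x := by
  have hs : 0 < s := hr.trans_le hrs
  obtain ⟨d, hb, hc⟩ := exists_cube_union_subset hxb hxc
  set T := Icc d (fun i => d i + (r + s)) with hT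
  have hsharp : meanDev f T (⨍ y in T, f y) ≤ sharpMaximal f x :=
    meanDev_average_le_sharpMaximal f ⟨d, r + s, by positivity, rfl⟩ (hb hxb)
  have h1 : meanDev f (Icc b (fun i => b i + r)) (⨍ y in T, f y) ≤ 3 ^ n * sharpMaximal f x :=
    (meanDev_le_mul hb (volume_cube_ne_zero b hr) (volume_cube_ne_top _ _)
      (volume_cube_le_mul b d 3 (by push_cast; linarith)) _).trans (by push_cast; gcongr)
  have h2 : ‖(⨍ y in T, f y) - ⨍ y in Icc c (fun i => c i + s), f y‖ₑ ≤
      3 ^ n * sharpMaximal f x := by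
    rw [← enorm_neg, neg_sub]
    refine (enorm_average_sub_le (integrableOn_cube hf c s) (volume_cube_ne_zero c hs)
      (volume_cube_ne_top _ _) _).trans ?_
    exact (meanDev_le_mul hc (volume_cube_ne_zero c hs) (volume_cube_ne_top _ _)
      (volume_cube_le_mul c d 3 (by push_cast; linarith)) _).trans (by push_cast; gcongr)
  calc _ ≤ _ := meanDev_le_add (volume_cube_ne_zero b hr) (volume_cube_ne_top _ _) _ (⨍ y in T, f y)
    _ ≤ 3 ^ n * sharpMaximal f x + 3 ^ n * sharpMaximal f x := add_le_add h1 h2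
    _ = _ := by ring

/-- Large cubes contribute little to the oscillation of the maximal function. -/
theorem meanDev_zero_le_of_large (hf : LocallyIntegrable f volume)
    {a b x y : Fin n → ℝ} {l r : ℝ} (hl : 0 < l) (hlr : l ≤ r)
    (hxa : x ∈ Icc a (fun i => a i + l)) (hya : y ∈ Icc a (fun i => a i + l))
    (hxb : x ∈ Icc b (fun i => b i + r)) :
    meanDev f (Icc b (fun i => b i + r)) 0 ≤ 2 ^ n * sharpMaximal f x + maximal f y := by
  have hr : 0 < r := hl.trans_le hlr
  obtain ⟨d, hb, ha⟩ := exists_cube_union_subset hxb hxa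
  set T := Icc d (fun i => d i + (r + l)) with hT
  have hTc : IsCube T := ⟨d, r + l, by positivity, rfl⟩
  refine (meanDev_le_add (volume_cube_ne_zero b hr) (volume_cube_ne_top _ _) _
    (⨍ y in T, f y)).trans (add_le_add ?_ ?_)
  · have hsharp := meanDev_average_le_sharpMaximal f hTc (hb hxb)
    exact (meanDev_le_mul hb (volume_cube_ne_zero b hr) (volume_cube_ne_top _ _)
      (volume_cube_le_mul b d 2 (by push_cast; linarith)) _).trans (by push_cast; gcongr)
  · exact (enorm_average_sub_le (integrableOn_cube hf d (r + l))
      (volume_cube_ne_zero d (by positivity)) (volume_cube_ne_top _ _) _).trans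
      (meanDev_zero_le_maximal f hTc (ha hya))

/-- A cube `R ∋ x` with side at least `l` is absorbed by a cube containing both `R` and the original
cube, hence also `y`. For a smaller one the chain is `R`, a dyadic cube at `x` of similar size, the
original cube, whose average is at most `M f (y)`. -/
theorem maximal_le_add_of_notMem_layer (hf : LocallyIntegrable f volume)
    {a x y : Fin n → ℝ} {l : ℝ} (hl : 0 < l) (hx : x ∈ gridCube a l (0, 0))
    (hy : y ∈ Icc a (fun i => a i + l)) {N : ℕ}
    (hN : x ∉ layer (gridCube a l) (stoppingCubes f a l) N (0, 0)) :
    maximal f x ≤ (2 * 3 ^ n + N * 2 ^ (n + 1)) * sharpMaximal f x + maximal f y := by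
  have hxa : x ∈ Icc a (fun i => a i + l) := by
    rw [← closedGridCube_zero]
    exact gridCube_subset_closed hl _ hx
  refine iSup_le fun R => iSup_le fun hR => iSup_le fun hxR => ?_
  obtain ⟨b, r, hr, rfl⟩ := hR
  rw [← meanDev_zero]
  rcases le_or_gt l r with h | h
  · refine (meanDev_zero_le_of_large hf hl h hxa hy hxR).trans ?_
    gcongr
    calc (2 : ℝ≥0∞) ^ n ≤ 3 ^ n := by gcongr; norm_num
      _ ≤ 2 * 3 ^ n := by rw [two_mul]; exact le_self_add
      _ ≤ _ := le_self_add
  -- The generation with `2 ^ m ≤ l / r < 2 ^ (m + 1)`, so that the dyadic side `l / 2 ^ m` lies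
  -- between `r` and `2 * r`.
  · obtain ⟨m, hm1, hm2⟩ := exists_nat_pow_near ((one_le_div hr).2 h.le) (one_lt_two (α := ℝ))
    have hpow : (0 : ℝ) < 2 ^ m := by positivity
    have h1 : r ≤ l / 2 ^ m := by
      rw [le_div_iff₀ hpow]; rw [le_div_iff₀ hr] at hm1; linarith
    have h2 : l / 2 ^ m ≤ 2 * r := by
      rw [div_le_iff₀ hpow]; rw [div_lt_iff₀ hr, pow_succ] at hm2; linarith
    have hxs := mem_gridCube_gridIndex a l m x
    set s := (m, gridIndex a l m x) with hs
    have hA : meanDev f (Icc b (fun i => b i + r)) (⨍ y in gridCube a l s, f y) ≤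
        2 * 3 ^ n * sharpMaximal f x := by
      rw [setAverage_congr (gridCube_ae_eq hl s)]
      exact meanDev_average_le_of_comparable hf hr h1 h2 hxR (gridCube_subset_closed hl s hxs)
    have hB : ‖(⨍ y in gridCube a l s, f y) - ⨍ y in gridCube a l (0, 0), f y‖ₑ ≤
        N * (2 ^ (n + 1) * sharpMaximal f x) :=
      enorm_gridAverage_sub_le_of_notMem_layer hf hl N (0, 0) hx hN s hxs (Nat.zero_le _)
    have hC : ‖(⨍ y in gridCube a l (0, 0), f y) - 0‖ₑ ≤ maximal f y := by
      rw [setAverage_congr (gridCube_ae_eq hl _), closedGridCube_zero]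
      exact (enorm_average_sub_le (integrableOn_cube hf a l) (volume_cube_ne_zero a hl)
        (volume_cube_ne_top _ _) _).trans (meanDev_zero_le_maximal f ⟨a, l, hl, rfl⟩ hy)
    calc meanDev f (Icc b (fun i => b i + r)) 0
        ≤ _ := meanDev_le_add (volume_cube_ne_zero b hr) (volume_cube_ne_top _ _) _
          (⨍ y in gridCube a l s, f y)
      _ ≤ 2 * 3 ^ n * sharpMaximal f x +
          (N * (2 ^ (n + 1) * sharpMaximal f x) + maximal f y) := by
          refine add_le_add hA (le_trans ?_ (add_le_add hB hC))
          refine le_trans (le_of_eq ?_) (enorm_add_le _ _)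
          congr 1; ring
      _ = _ := by ring

/-- Outside the `N`-th layer of stopping cubes, the lower oscillation of the maximal function is at
most `O(N)` times the sharp maximal function. -/
theorem maximalOsc_le_of_notMem_layer (hf : LocallyIntegrable f volume)
    {a x : Fin n → ℝ} {l : ℝ} (hl : 0 < l) (hx : x ∈ gridCube a l (0, 0)) {N : ℕ}
    (hN : x ∉ layer (gridCube a l) (stoppingCubes f a l) N (0, 0)) :
    maximalOsc f (Icc a (fun i => a i + l)) x ≤
      (2 * 3 ^ n + N * 2 ^ (n + 1)) * sharpMaximal f x := by
  -- Truncated subtraction moves the essential infimum to the right-hand side without any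
  -- finiteness, leaving a lower bound for it.
  rw [maximalOsc, tsub_le_iff_left, add_comm, ← tsub_le_iff_left]
  refine le_essInf_of_ae_le _ ?_
  filter_upwards [ae_restrict_mem measurableSet_Icc] with y hy
  rw [tsub_le_iff_left]
  exact maximal_le_add_of_notMem_layer hf hl hx hy hN

end Comparison

/-! ### The Fujii-Wilson constant and the weighted decay -/

section Weight

variable {n : ℕ} {w : (Fin n → ℝ) → ℝ}

theorem weightMeasure_absolutelyContinuous (w : (Fin n → ℝ) → ℝ) :
    weightMeasure w ≪ volume :=
  withDensity_absolutelyContinuous _ _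

theorem weightMeasure_apply (w : (Fin n → ℝ) → ℝ) {S : Set (Fin n → ℝ)} (hS : MeasurableSet S) :
    weightMeasure w S = ∫⁻ x in S, ENNReal.ofReal (w x) :=
  withDensity_apply _ hS

theorem IsCube.measurableSet {Q : Set (Fin n → ℝ)} (hQ : IsCube Q) : MeasurableSet Q := by
  obtain ⟨a, l, -, rfl⟩ := hQ
  exact measurableSet_Icc

theorem IsWeight.measure_ne_top (hw : IsWeight w) {Q : Set (Fin n → ℝ)} (hQ : IsCube Q) :
    weightMeasure w Q ≠ ∞ := by
  rw [weightMeasure_apply w hQ.measurableSet]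
  obtain ⟨a, l, hl, rfl⟩ := hQ
  exact ((integrableOn_cube hw.locallyIntegrable a l).lintegral_lt_top).ne

theorem IsWeight.measure_ne_zero (hw : IsWeight w) {Q : Set (Fin n → ℝ)} (hQ : IsCube Q) :
    weightMeasure w Q ≠ 0 := by
  obtain ⟨a, l, hl, rfl⟩ := hQ
  rw [weightMeasure_apply w measurableSet_Icc]
  intro h
  have hm : AEMeasurable (fun x => ENNReal.ofReal (w x))
      (volume.restrict (Icc a fun i => a i + l)) :=
    (hw.locallyIntegrable.aestronglyMeasurable.aemeasurable.ennreal_ofReal).restrict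
  rw [lintegral_eq_zero_iff' hm] at h
  have hfalse : ∀ᵐ x ∂volume.restrict (Icc a fun i => a i + l), False := by
    filter_upwards [h, ae_restrict_of_ae hw.pos] with x hx hp
    simp only [Pi.zero_apply, ENNReal.ofReal_eq_zero] at hx
    exact hx.not_gt hp
  rw [ae_iff] at hfalse
  refine volume_cube_ne_zero a hl ?_
  simpa using hfalse

theorem setLIntegral_maximal_le (hw : IsWeight w) {Q : Set (Fin n → ℝ)} (hQ : IsCube Q) :
    ∫⁻ x in Q, maximal (Q.indicator w) x ≤ aInftyConst w * weightMeasure w Q := by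
  have h : (weightMeasure w Q)⁻¹ * ∫⁻ x in Q, maximal (Q.indicator w) x ≤ aInftyConst w :=
    le_iSup₂_of_le Q hQ le_rfl
  rw [mul_comm, ← div_eq_mul_inv] at h
  exact (ENNReal.div_le_iff (hw.measure_ne_zero hQ) (hw.measure_ne_top hQ)).1 h

/-- This supplies the pointwise hypothesis of the packing bound with `g = M(w χ_Q)`. The closed cube
`R` competes in the supremum, while the half-open `S` belongs to the grid. -/
theorem weightMeasure_le_mul_maximal {Q R S : Set (Fin n → ℝ)} (hR : IsCube R)
    (hS : MeasurableSet S) (hSR : S =ᵐ[volume] R) (hSQ : S ⊆ Q) {x : Fin n → ℝ} (hx : x ∈ R) :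
    weightMeasure w S ≤ volume S * maximal (Q.indicator w) x := by
  have hv0 : volume R ≠ 0 := by
    obtain ⟨a, l, hl, rfl⟩ := hR; exact volume_cube_ne_zero a hl
  have hvt : volume R ≠ ∞ := by
    obtain ⟨a, l, hl, rfl⟩ := hR; exact volume_cube_ne_top a l
  calc weightMeasure w S = ∫⁻ y in S, ENNReal.ofReal (w y) := weightMeasure_apply w hS
    _ ≤ ∫⁻ y in S, ‖Q.indicator w y - 0‖ₑ := by
        refine setLIntegral_mono' hS fun y hy => ?_
        rw [indicator_of_mem (hSQ hy), sub_zero]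
        exact Real.ofReal_le_enorm _
    _ = volume R * meanDev (Q.indicator w) R 0 := by
        rw [meanDev, ← mul_assoc, ENNReal.mul_inv_cancel hv0 hvt, one_mul,
          Measure.restrict_congr_set hSR]
    _ ≤ _ := by
        rw [measure_congr hSR]
        gcongr
        exact meanDev_zero_le_maximal _ hR hx

/-- On the unit cube `Q`, `M(w χ_Q)` is at least the average `w(Q)`. The bound lets rounding `4 [w]`
up to an integer cost only a constant factor. -/
theorem one_le_aInftyConst (hw : IsWeight w) : 1 ≤ aInftyConst w := by
  have hQ : IsCube (Icc (0 : Fin n → ℝ) (fun i => (0 : Fin n → ℝ) i + 1)) := ⟨0, 1, one_pos, rfl⟩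
  set Q := Icc (0 : Fin n → ℝ) (fun i => (0 : Fin n → ℝ) i + 1)
  have hv : volume Q = 1 := (volume_Icc_cube _ _).trans (by simp)
  have h : weightMeasure w Q ≤ aInftyConst w * weightMeasure w Q := by
    calc weightMeasure w Q = ∫⁻ x in Q, weightMeasure w Q := by
          rw [setLIntegral_const, hv, mul_one]
      _ ≤ ∫⁻ x in Q, maximal (Q.indicator w) x := by
          refine setLIntegral_mono' hQ.measurableSet fun x hx => ?_
          have := weightMeasure_le_mul_maximal (w := w) hQ hQ.measurableSet
            Filter.EventuallyEq.rfl (subset_refl Q) hx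
          rwa [hv, one_mul] at this
      _ ≤ _ := setLIntegral_maximal_le hw hQ
  rw [← one_mul (weightMeasure w Q), ← mul_assoc, mul_one] at h
  exact (ENNReal.mul_le_mul_iff_left (hw.measure_ne_zero hQ) (hw.measure_ne_top hQ)).1 h

/-- The packing bound with `g = M(w χ_Q)`, whose integral over the cube is what the Fujii-Wilson
constant controls. -/
theorem sum_weightMeasure_layer_le (hw : IsWeight w) {a : Fin n → ℝ} {l : ℝ} (hl : 0 < l)
    {next : ℕ × (Fin n → ℤ) → Set (ℕ × (Fin n → ℤ))}
    (h : IsSparse volume (gridCube a l) next) (N : ℕ) (Q : ℕ × (Fin n → ℤ)) :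
    ∑ k ∈ Finset.range N, weightMeasure w (layer (gridCube a l) next k Q) ≤
      2 * aInftyConst w * weightMeasure w (gridCube a l Q) := by
  have hQ := isCube_closedGridCube (a := a) hl Q
  have hae := gridCube_ae_eq (a := a) hl Q
  calc _ ≤ 2 * ∫⁻ x in gridCube a l Q, maximal ((closedGridCube a l Q).indicator w) x := by
        refine h.sum_measure_layer_le N Q fun S hS x hx => ?_
        exact weightMeasure_le_mul_maximal (isCube_closedGridCube hl S)
          (measurableSet_gridCube hl S) (gridCube_ae_eq hl S)
          (hS.trans (gridCube_subset_closed hl Q)) (gridCube_subset_closed hl S hx)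
    _ ≤ _ := by
        rw [Measure.restrict_congr_set hae,
          measure_congr ((weightMeasure_absolutelyContinuous w).ae_eq hae), mul_assoc]
        gcongr
        exact setLIntegral_maximal_le hw hQ

/-- The weighted measure of the set where the lower oscillation of `M f` is large relative to
`M^♯ f` decays geometrically. -/
theorem weightMeasure_maximalOsc_le {f : (Fin n → ℝ) → ℝ} (hf : LocallyIntegrable f volume)
    (hw : IsWeight w) {Q : Set (Fin n → ℝ)} (hQ : IsCube Q) {L : ℕ} (hL0 : L ≠ 0)
    (hL : 4 * aInftyConst w ≤ L) (k : ℕ) :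
    weightMeasure w {x | x ∈ Q ∧
        (2 * 3 ^ n + (k * L : ℕ) * 2 ^ (n + 1)) * sharpMaximal f x < maximalOsc f Q x} ≤
      2⁻¹ ^ k * weightMeasure w Q := by
  obtain ⟨a, l, hl, rfl⟩ := hQ
  have hsp := isSparse_stoppingCubes f a hl
  have hae := gridCube_ae_eq (a := a) hl (0, 0)
  rw [closedGridCube_zero] at hae
  have hae' := (weightMeasure_absolutelyContinuous w).ae_eq hae
  -- The faces of the closed cube missing from the half-open one have no weight.
  have hnull : weightMeasure w ((Icc a fun i => a i + l) \ gridCube a l (0, 0)) = 0 :=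
    ae_le_set.1 hae'.symm.le
  rw [← measure_congr hae']
  refine le_trans (measure_mono (t := layer (gridCube a l) (stoppingCubes f a l) (k * L) (0, 0) ∪
    ((Icc a fun i => a i + l) \ gridCube a l (0, 0))) fun x hx => ?_) <|
    (measure_union_le _ _).trans ?_
  · by_contra hcon
    rw [mem_union, not_or, Set.mem_sdiff, not_and_not_right] at hcon
    exact (maximalOsc_le_of_notMem_layer hf hl (hcon.2 hx.1) hcon.1).not_gt hx.2
  · rw [hnull, add_zero]
    refine hsp.measure_layer_mul_le (A := 2 * aInftyConst w)
      (sum_weightMeasure_layer_le hw hl hsp) hL0 (le_of_eq_of_le ?_ hL) k (0, 0)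
    ring

end Weight

/-! ### From exponential decay to the `exp L` norm -/

section ExpIntegrability

/-- A discrete layer-cake formula with levels `k * log (3 / 2)`. For finite `y` the active indices
are those below `K = ⌈y / log (3 / 2)⌉`, their coefficients sum to `(3 / 2) ^ K - 1`, and `exp y ≤
(3 / 2) ^ K`. For `y = ∞` infinitely many terms are at least `1 / 2`. -/
theorem exp_sub_one_le_tsum (y : ℝ≥0∞) :
    EReal.exp (y : EReal) - 1 ≤ ∑' k : ℕ, ENNReal.ofReal (2⁻¹ * (3 / 2) ^ k) *
      {z : ℝ≥0∞ | ENNReal.ofReal (k * Real.log (3 / 2)) < z}.indicator 1 y := by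
  have hh : 0 < Real.log (3 / 2) := Real.log_pos (by norm_num)
  induction y with
  | top =>
    refine le_top.trans ((ENNReal.tsum_const_eq_top_of_ne_zero (α := ℕ)
      (c := ENNReal.ofReal 2⁻¹) (by simp)).ge.trans (ENNReal.tsum_le_tsum fun k => ?_))
    have hk : ∞ ∈ {z : ℝ≥0∞ | ENNReal.ofReal (k * Real.log (3 / 2)) < z} := ENNReal.ofReal_lt_top
    rw [indicator_of_mem hk, Pi.one_apply, mul_one]
    refine ENNReal.ofReal_le_ofReal ?_
    have : (1 : ℝ) ≤ (3 / 2) ^ k := one_le_pow₀ (by norm_num)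
    linarith
  | coe y =>
    set K := ⌈(y : ℝ) / Real.log (3 / 2)⌉₊ with hK
    have hsum : ∑ k ∈ Finset.range K, (2⁻¹ * (3 / 2 : ℝ) ^ k) = (3 / 2) ^ K - 1 := by
      rw [← Finset.mul_sum, geom_sum_eq (by norm_num)]
      ring
    have hle : Real.exp y ≤ (3 / 2 : ℝ) ^ K := by
      rw [← Real.exp_log (show (0 : ℝ) < 3 / 2 by norm_num), ← Real.exp_nat_mul]
      exact Real.exp_le_exp.2 ((div_le_iff₀ hh).1 (Nat.le_ceil _))
    calc EReal.exp (((y : ℝ≥0∞)) : EReal) - 1 = ENNReal.ofReal (Real.exp y - 1) := by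
          rw [ENNReal.ofReal_sub _ zero_le_one, ENNReal.ofReal_one]
          rfl
      _ ≤ ENNReal.ofReal (∑ k ∈ Finset.range K, (2⁻¹ * (3 / 2 : ℝ) ^ k)) := by
          rw [hsum]; exact ENNReal.ofReal_le_ofReal (by linarith)
      _ = ∑ k ∈ Finset.range K, ENNReal.ofReal (2⁻¹ * (3 / 2 : ℝ) ^ k) :=
          ENNReal.ofReal_sum_of_nonneg fun k _ => by positivity
      _ = ∑ k ∈ Finset.range K, ENNReal.ofReal (2⁻¹ * (3 / 2) ^ k) *
          {z : ℝ≥0∞ | ENNReal.ofReal (k * Real.log (3 / 2)) < z}.indicator 1 (y : ℝ≥0∞) := by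
          refine Finset.sum_congr rfl fun k hk => ?_
          have hky : (k : ℝ) * Real.log (3 / 2) < y :=
            (lt_div_iff₀ hh).1 (Nat.lt_ceil.1 (Finset.mem_range.1 hk))
          rw [indicator_of_mem, Pi.one_apply, mul_one]
          rw [mem_ofPred_eq, ← ENNReal.ofReal_coe_nnreal]
          exact (ENNReal.ofReal_lt_ofReal_iff_of_nonneg (by positivity)).2 hky
      _ ≤ _ := ENNReal.sum_le_tsum _

/-- Exponential decay of the distribution function bounds the norm in `exp L`. -/
theorem expLNorm_le_of_decay {α : Type*} [MeasurableSpace α] {μ : Measure α} {g : α → ℝ≥0∞}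
    {c b : ℝ} (hc : 0 < c) (hb : 0 < b) (hμ : μ univ ≤ 1)
    (hg : ∀ t, 0 < t → μ {x | ENNReal.ofReal t < g x} ≤ ENNReal.ofReal (c * Real.exp (-(b * t)))) :
    expLNorm g μ ≤ ENNReal.ofReal (Real.log (3 * (c + 1)) / (b * Real.log (3 / 2))) := by
  have hh : 0 < Real.log (3 / 2) := Real.log_pos (by norm_num)
  have hlog : 0 < Real.log (3 * (c + 1)) := Real.log_pos (by linarith)
  -- Chosen so that the decay at level `k * log (3 / 2) * s` is `c * (3 * (c + 1))⁻¹ ^ k`. The `3`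
  -- turns the coefficient `(3 / 2) ^ k` into `2⁻¹ ^ k`, and `c + 1` absorbs `c` once `k ≥ 1`. The
  -- terms are then at most `2⁻¹ ^ (k + 1)`, with sum `1`.
  set s := Real.log (3 * (c + 1)) / (b * Real.log (3 / 2)) with hs
  have hs0 : 0 < s := by positivity
  refine iInf_le_of_le s.toNNReal <| iInf_le_of_le (Real.toNNReal_pos.2 hs0) <|
    iInf_le_of_le ?_ le_rfl
  change ∫⁻ x, (EReal.exp ((g x / ENNReal.ofReal s : ℝ≥0∞) : EReal) - 1) ∂μ ≤ 1
  set F : ℕ → Set α := fun k => {x | ENNReal.ofReal (k * Real.log (3 / 2) * s) < g x} with hF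
  have hterm : ∀ k, ENNReal.ofReal (2⁻¹ * (3 / 2) ^ k) * μ (F k) ≤ 2⁻¹ ^ (k + 1) := by
    intro k
    -- At level zero decay is not assumed; the total mass is used instead.
    rcases Nat.eq_zero_or_pos k with rfl | hk
    · calc ENNReal.ofReal (2⁻¹ * (3 / 2) ^ 0) * μ (F 0) ≤ ENNReal.ofReal (2⁻¹ * (3 / 2) ^ 0) * 1 := by
            gcongr; exact (measure_mono (subset_univ _)).trans hμ
        _ = 2⁻¹ ^ (0 + 1) := by
            simp [ENNReal.ofReal_inv_of_pos]
    · have hk' : (0 : ℝ) < k := by exact_mod_cast hk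
      have hexp : Real.exp (-(b * (k * Real.log (3 / 2) * s))) = (3 * (c + 1))⁻¹ ^ k := by
        rw [← Real.exp_log (show 0 < (3 * (c + 1))⁻¹ by positivity), ← Real.exp_nat_mul,
          Real.log_inv]
        congr 1
        rw [hs]
        field_simp
      have hpow : c * (c + 1)⁻¹ ^ k ≤ 1 := by
        rw [inv_pow, ← div_eq_mul_inv, div_le_one (by positivity)]
        calc c ≤ (c + 1) ^ 1 := by linarith
          _ ≤ (c + 1) ^ k := pow_le_pow_right₀ (by linarith) hk
      calc ENNReal.ofReal (2⁻¹ * (3 / 2) ^ k) * μ (F k)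
          ≤ ENNReal.ofReal (2⁻¹ * (3 / 2) ^ k) *
            ENNReal.ofReal (c * Real.exp (-(b * (k * Real.log (3 / 2) * s)))) := by
            gcongr; exact hg _ (by positivity)
        _ = ENNReal.ofReal (2⁻¹ ^ (k + 1) * (c * (c + 1)⁻¹ ^ k)) := by
            rw [← ENNReal.ofReal_mul (by positivity), hexp]
            congr 1
            rw [mul_inv, mul_pow, pow_succ (2⁻¹ : ℝ), show (3 / 2 : ℝ) = 3 * 2⁻¹ by norm_num, mul_pow]
            have h3 : (3 : ℝ) ^ k * (3⁻¹) ^ k = 1 := by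
              rw [← mul_pow]; norm_num
            linear_combination (2⁻¹ * 2⁻¹ ^ k * c * (c + 1)⁻¹ ^ k) * h3
        _ ≤ ENNReal.ofReal (2⁻¹ ^ (k + 1)) := by
            refine ENNReal.ofReal_le_ofReal (mul_le_of_le_one_right (by positivity) hpow)
        _ = 2⁻¹ ^ (k + 1) := by
            rw [ENNReal.ofReal_pow (by positivity), ENNReal.ofReal_inv_of_pos two_pos]
            simp
  -- Measurable hulls of the level sets allow summing termwise without measurability of `g`.
  calc ∫⁻ x, (EReal.exp ((g x / ENNReal.ofReal s : ℝ≥0∞) : EReal) - 1) ∂μ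
      ≤ ∫⁻ x, ∑' k : ℕ, (toMeasurable μ (F k)).indicator
          (fun _ => ENNReal.ofReal (2⁻¹ * (3 / 2) ^ k)) x ∂μ := by
        refine lintegral_mono fun x => (exp_sub_one_le_tsum _).trans ?_
        refine ENNReal.tsum_le_tsum fun k => ?_
        by_cases hx : g x / ENNReal.ofReal s ∈ {z | ENNReal.ofReal (k * Real.log (3 / 2)) < z}
        · have hxF : x ∈ F k := by
            rw [hF, mem_ofPred_eq, ENNReal.ofReal_mul (by positivity)]
            exact ENNReal.mul_lt_of_lt_div hx
          rw [indicator_of_mem (subset_toMeasurable μ _ hxF), indicator_of_mem hx, Pi.one_apply,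
            mul_one]
        · rw [indicator_of_notMem hx, mul_zero]
          exact zero_le
    _ = ∑' k : ℕ, ENNReal.ofReal (2⁻¹ * (3 / 2) ^ k) * μ (F k) := by
        rw [lintegral_tsum fun k =>
          (measurable_const.indicator (measurableSet_toMeasurable _ _)).aemeasurable]
        refine tsum_congr fun k => ?_
        rw [lintegral_indicator_const (measurableSet_toMeasurable _ _), measure_toMeasurable]
    _ ≤ ∑' k : ℕ, 2⁻¹ ^ (k + 1) := ENNReal.tsum_le_tsum hterm
    _ = 1 := by
        rw [ENNReal.tsum_geometric_add_one, ENNReal.one_sub_inv_two, inv_inv]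
        exact ENNReal.inv_mul_cancel (by simp) (by simp)

end ExpIntegrability

/-! ### The distributional inequality in terms of `t` -/

section Decay

/-- Geometric decay in steps of length proportional to `W` is exponential decay at rate `1 / W`. -/
theorem exists_step_count {A C : ℝ} (hA : 0 < A) (hC : 0 < C) {W t : ℝ} (hW : 1 ≤ W) :
    1 ≤ 2 * Real.exp (Real.log 2 / (5 * C) * A) *
        Real.exp (-(Real.log 2 / (5 * C) * t / W)) ∨
      ∃ L k : ℕ, L ≠ 0 ∧ 4 * W ≤ L ∧ A + (k * L : ℕ) * C ≤ t ∧
        2⁻¹ ^ k ≤ 2 * Real.exp (Real.log 2 / (5 * C) * A) *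
          Real.exp (-(Real.log 2 / (5 * C) * t / W)) := by
  have hlog : 0 < Real.log 2 := Real.log_pos one_lt_two
  have hW0 : 0 < W := one_pos.trans_le hW
  -- Shifting by the initial cost `A` loses only a fixed factor, because `W ≥ 1`. For `t < A` this
  -- already makes the right-hand side at least `1`.
  have hbase : ∀ T, Real.exp (-(Real.log 2 / (5 * C) * (T - A) / W)) ≤
      Real.exp (Real.log 2 / (5 * C) * A) * Real.exp (-(Real.log 2 / (5 * C) * T / W)) := by
    intro T
    rw [← Real.exp_add]
    refine Real.exp_le_exp.2 ?_
    have h1 : Real.log 2 / (5 * C) * A / W ≤ Real.log 2 / (5 * C) * A :=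
      div_le_self (by positivity) hW
    have h2 : -(Real.log 2 / (5 * C) * (T - A) / W) =
      Real.log 2 / (5 * C) * A / W - Real.log 2 / (5 * C) * T / W := by ring
    linarith
  rcases lt_or_ge t A with h | h
  · left
    have h1 : 1 ≤ Real.exp (-(Real.log 2 / (5 * C) * (t - A) / W)) := by
      refine Real.one_le_exp ?_
      have : 0 ≤ Real.log 2 / (5 * C) * (A - t) / W := by
        have := sub_pos.2 h
        positivity
      linarith [show -(Real.log 2 / (5 * C) * (t - A) / W) =
        Real.log 2 / (5 * C) * (A - t) / W by ring]
    have h2 := h1.trans (hbase t)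
    rw [mul_assoc]
    linarith
  · right
    -- `L = ⌈4 * W⌉ ≤ 5 * W` is the source of the `5` in the rate. The largest admissible `k` is a
    -- floor, and the lost fractional part costs the factor `2`.
    have hLle := Nat.le_ceil (4 * W)
    have hLlt := Nat.ceil_lt_add_one (show 0 ≤ 4 * W by positivity)
    set L := ⌈4 * W⌉₊
    have hL0 : (0 : ℝ) < L := by linarith
    have hL5 : (L : ℝ) ≤ 5 * W := by linarith
    have htA : 0 ≤ t - A := sub_nonneg.2 h
    have hkle := Nat.floor_le (show 0 ≤ (t - A) / (C * L) by positivity)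
    have hklt := Nat.lt_floor_add_one ((t - A) / (C * L))
    set k := ⌊(t - A) / (C * L)⌋₊
    refine ⟨L, k, by exact_mod_cast hL0.ne', hLle, ?_, ?_⟩
    · rw [le_div_iff₀ (by positivity)] at hkle
      push_cast
      linarith
    · have h1 : (2⁻¹ : ℝ) ^ k = 2 * Real.exp (-(Real.log 2 * (k + 1))) := by
        rw [show -(Real.log 2 * ((k : ℝ) + 1)) = k * Real.log 2⁻¹ + Real.log 2⁻¹ by
          rw [Real.log_inv]; ring, Real.exp_add, Real.exp_nat_mul, Real.exp_log (by norm_num)]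
        ring
      have h2 : (t - A) / (C * (5 * W)) ≤ k + 1 :=
        le_trans (by gcongr) hklt.le
      rw [h1, mul_assoc]
      refine mul_le_mul_of_nonneg_left (le_trans (Real.exp_le_exp.2 ?_) (hbase t)) zero_le_two
      have h3 := mul_le_mul_of_nonneg_left h2 hlog.le
      have h4 : Real.log 2 / (5 * C) * (t - A) / W = Real.log 2 * ((t - A) / (C * (5 * W))) := by
        field_simp
      linarith

/-- Geometric decay is read at the number of layers that `t` affords: `2 * 3 ^ n` is the initial
cost, `2 ^ (n + 1)` the cost of a layer, and `4 [w]` the number of layers, up to rounding, per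
halving. -/
theorem exists_weightMeasure_oscQuotient_le (n : ℕ) :
    ∃ c₁ c₂ : ℝ, 0 < c₁ ∧ 0 < c₂ ∧
      ∀ f : (Fin n → ℝ) → ℝ, LocallyIntegrable f volume →
        ∀ w : (Fin n → ℝ) → ℝ, IsAInfty w →
          ∀ t : ℝ, 0 < t → ∀ Q : Set (Fin n → ℝ), IsCube Q →
            weightMeasure w {x | x ∈ Q ∧ ENNReal.ofReal t < oscQuotient f Q x} ≤
              ENNReal.ofReal (c₁ * Real.exp (-(c₂ * t / (aInftyConst w).toReal))) *
                weightMeasure w Q := by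
  have hA : (0 : ℝ) < 2 * 3 ^ n := by positivity
  have hC : (0 : ℝ) < 2 ^ (n + 1) := by positivity
  have hlog : 0 < Real.log 2 := Real.log_pos one_lt_two
  refine ⟨2 * Real.exp (Real.log 2 / (5 * 2 ^ (n + 1)) * (2 * 3 ^ n)),
    Real.log 2 / (5 * 2 ^ (n + 1)), by positivity, by positivity, fun f hf w hw t ht Q hQ => ?_⟩
  have hWt := hw.const_lt_top.ne
  have hW : 1 ≤ (aInftyConst w).toReal := by
    rw [← ENNReal.toReal_one]
    exact ENNReal.toReal_mono hWt (one_le_aInftyConst hw.toIsWeight)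
  rcases exists_step_count hA hC (t := t) hW with h | ⟨L, k, hL0, hL, hkt, hk⟩
  · calc weightMeasure w {x | x ∈ Q ∧ ENNReal.ofReal t < oscQuotient f Q x}
        ≤ 1 * weightMeasure w Q := by
          rw [one_mul]; exact measure_mono fun x hx => hx.1
      _ ≤ _ := by
          gcongr
          exact ENNReal.one_le_ofReal.2 h
  · have hL' : 4 * aInftyConst w ≤ L := by
      rw [← ENNReal.ofReal_toReal hWt, show (4 : ℝ≥0∞) = ENNReal.ofReal 4 by simp,
        ← ENNReal.ofReal_mul (by norm_num), ← ENNReal.ofReal_natCast]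
      exact ENNReal.ofReal_le_ofReal hL
    have hcoef : (2 * 3 ^ n + (k * L : ℕ) * 2 ^ (n + 1) : ℝ≥0∞) ≤ ENNReal.ofReal t := by
      refine le_trans (le_of_eq ?_) (ENNReal.ofReal_le_ofReal hkt)
      rw [ENNReal.ofReal_add (by positivity) (by positivity), ENNReal.ofReal_mul (by positivity),
        ENNReal.ofReal_mul (by positivity), ENNReal.ofReal_pow (by positivity),
        ENNReal.ofReal_pow (by positivity), ENNReal.ofReal_natCast]
      simp
    calc weightMeasure w {x | x ∈ Q ∧ ENNReal.ofReal t < oscQuotient f Q x}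
        ≤ weightMeasure w {x | x ∈ Q ∧ (2 * 3 ^ n + (k * L : ℕ) * 2 ^ (n + 1)) *
            sharpMaximal f x < maximalOsc f Q x} :=
          measure_mono fun x hx => ⟨hx.1, lt_of_le_of_lt (by gcongr)
            (ENNReal.mul_lt_of_lt_div hx.2)⟩
      _ ≤ 2⁻¹ ^ k * weightMeasure w Q :=
          weightMeasure_maximalOsc_le hf hw.toIsWeight hQ hL0 hL' k
      _ ≤ _ := by
          gcongr
          refine le_trans (le_of_eq ?_) (ENNReal.ofReal_le_ofReal hk)
          rw [ENNReal.ofReal_pow (by positivity), ENNReal.ofReal_inv_of_pos two_pos]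
          simp

end Decay

end MaximalBLO

/-! ### The three estimates -/

theorem corollary1 (n : ℕ) :
    (∃ c₁ c₂ : ℝ, 0 < c₁ ∧ 0 < c₂ ∧
      ∀ f : (Fin n → ℝ) → ℝ, LocallyIntegrable f volume →
        (¬ ∃ a : ℝ, ∀ᵐ x, f x = a) → (∃ x, MaximalBLO.maximal f x ≠ ∞) →
        ∀ w : (Fin n → ℝ) → ℝ, MaximalBLO.IsAInfty w →
          ∀ t : ℝ, 0 < t → ∀ Q : Set (Fin n → ℝ), MaximalBLO.IsCube Q →
            MaximalBLO.weightMeasure w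
                {x | x ∈ Q ∧ ENNReal.ofReal t < MaximalBLO.oscQuotient f Q x} ≤
              ENNReal.ofReal
                  (c₁ * Real.exp (-(c₂ * t / (MaximalBLO.aInftyConst w).toReal))) *
                MaximalBLO.weightMeasure w Q) ∧
    (∃ c : ℝ, 0 < c ∧
      ∀ f : (Fin n → ℝ) → ℝ, LocallyIntegrable f volume →
        (¬ ∃ a : ℝ, ∀ᵐ x, f x = a) → (∃ x, MaximalBLO.maximal f x ≠ ∞) →
        ∀ w : (Fin n → ℝ) → ℝ, MaximalBLO.IsAInfty w →
          ∀ Q : Set (Fin n → ℝ), MaximalBLO.IsCube Q →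
            MaximalBLO.expLNorm (MaximalBLO.oscQuotient f Q)
                (MaximalBLO.normalizedWeight w Q) ≤
              ENNReal.ofReal c * MaximalBLO.aInftyConst w) ∧
    (∃ c₁ c₂ : ℝ, 0 < c₁ ∧ 0 < c₂ ∧
      ∀ f : (Fin n → ℝ) → ℝ, LocallyIntegrable f volume →
        (¬ ∃ a : ℝ, ∀ᵐ x, f x = a) → (∃ x, MaximalBLO.maximal f x ≠ ∞) →
        ∀ w : (Fin n → ℝ) → ℝ, MaximalBLO.IsAInfty w →
          ∀ Q : Set (Fin n → ℝ), MaximalBLO.IsCube Q →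
            ∀ lam gam : ℝ, 0 < lam → 0 < gam →
              MaximalBLO.weightMeasure w
                  {x | x ∈ Q ∧ ENNReal.ofReal lam < MaximalBLO.maximalOsc f Q x ∧
                    MaximalBLO.sharpMaximal f x ≤ ENNReal.ofReal (gam * lam)} ≤
                ENNReal.ofReal
                    (c₁ * Real.exp (-(c₂ / ((MaximalBLO.aInftyConst w).toReal * gam)))) *
                  MaximalBLO.weightMeasure w Q) := by
  obtain ⟨c₁, c₂, hc₁, hc₂, h⟩ := MaximalBLO.exists_weightMeasure_oscQuotient_le n
  have hW : ∀ w : (Fin n → ℝ) → ℝ, MaximalBLO.IsAInfty w → 0 < (MaximalBLO.aInftyConst w).toReal :=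
    fun w hw => ENNReal.toReal_pos
      (one_pos.trans_le (MaximalBLO.one_le_aInftyConst hw.toIsWeight)).ne' hw.const_lt_top.ne
  refine ⟨⟨c₁, c₂, hc₁, hc₂, fun f hf _ _ => h f hf⟩,
    ⟨Real.log (3 * (c₁ + 1)) / (c₂ * Real.log (3 / 2)), ?_, fun f hf _ _ w hw Q hQ => ?_⟩,
    ⟨c₁, c₂, hc₁, hc₂, fun f hf _ _ w hw Q hQ lam gam hlam hgam => ?_⟩⟩
  · have h1 : 0 < Real.log (3 / 2) := Real.log_pos (by norm_num)
    have h2 : 0 < Real.log (3 * (c₁ + 1)) := Real.log_pos (by linarith)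
    positivity
  · have hQ0 := hw.toIsWeight.measure_ne_zero hQ
    have hQt := hw.toIsWeight.measure_ne_top hQ
    have happ : ∀ S, MaximalBLO.normalizedWeight w Q S =
        (MaximalBLO.weightMeasure w Q)⁻¹ * MaximalBLO.weightMeasure w (S ∩ Q) := fun S => by
      rw [MaximalBLO.normalizedWeight, Measure.smul_apply, smul_eq_mul,
        Measure.restrict_apply' hQ.measurableSet]
    have hW0 := hW w hw
    -- The norm bound is inversely proportional to the decay rate `c₂ / [w]`, hence linear in `[w]`.
    refine (MaximalBLO.expLNorm_le_of_decay (c := c₁)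
      (b := c₂ / (MaximalBLO.aInftyConst w).toReal) hc₁ (by positivity) ?_ fun t ht => ?_).trans
      (le_of_eq ?_)
    · rw [happ, univ_inter, ENNReal.inv_mul_cancel hQ0 hQt]
    · have h1 := h f hf w hw t ht Q hQ
      rw [happ, mul_comm, ← div_eq_mul_inv]
      refine (ENNReal.div_le_iff hQ0 hQt).2 (le_trans (measure_mono ?_) (h1.trans_eq ?_))
      · exact fun x hx => ⟨hx.2, hx.1⟩
      · rw [div_mul_eq_mul_div]
    · rw [← ENNReal.ofReal_toReal hw.const_lt_top.ne, ← ENNReal.ofReal_mul' hW0.le,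
        ENNReal.toReal_ofReal hW0.le]
      congr 1
      field_simp
  -- Oscillation above `λ` with `M^♯ f (x) ≤ γ λ` forces the quotient above `1 / γ`; if `M^♯ f (x) =
  -- 0` the quotient is infinite.
  · have h1 := h f hf w hw (1 / gam) (by positivity) Q hQ
    refine le_trans (measure_mono ?_) (h1.trans_eq ?_)
    · refine fun x hx => ⟨hx.1, ?_⟩
      have hne : MaximalBLO.sharpMaximal f x ≠ ∞ := (hx.2.2.trans_lt ENNReal.ofReal_lt_top).ne
      refine (ENNReal.lt_div_iff_mul_lt (.inr ENNReal.ofReal_ne_top) (.inl hne)).2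
        (lt_of_le_of_lt ?_ hx.2.1)
      calc ENNReal.ofReal (1 / gam) * MaximalBLO.sharpMaximal f x
          ≤ ENNReal.ofReal (1 / gam) * ENNReal.ofReal (gam * lam) := by gcongr; exact hx.2.2
        _ = ENNReal.ofReal lam := by
          rw [← ENNReal.ofReal_mul (by positivity)]
          congr 1
          field_simp
    · congr 4
      rw [mul_one_div, div_div, mul_comm gam]
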